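/- Let $N\ge 1$. Put $c_N=\pi^{-N/2}\,\Gamma(N/2)$ and $\rho_N=2\log 2+\psi(N/2)-\gamma$, where $\psi=\Gamma'/\Gamma$ is the digamma function and $\gamma$ is the Euler--Mascheroni constant, and let $$k(z)=\frac{c_N}{|z|^N}\chi_{B_1}(z),\qquad j(z)=\frac{c_N}{|z|^N}\chi_{\mathbb R^N\setminus B_1}(z)\qquad (z\in\mathbb R^N,\ z\ne 0),$$ where $B_1$ is the open unit ball centred at the origin. For measurable $u,v:\mathbb R^N\to\mathbb R$ set $$\mathcal E(u,v)=\frac12\iint_{\mathbb R^N\times\mathbb R^N}(u(x)-u(y))(v(x)-v(y))\,k(x-y)\,dx\,dy .$$ Let $\mathbb H(\mathbb R^N)$ be the space of all measurable $u:\mathbb R^N\to\mathbb R$ with $u\in L^2(\mathbb R^N)$ and $\mathcal E(u,u)<\infty$, and for open $\Omega\subset\mathbb R^N$ let $\mathbb H(\Omega)=\{u\in\mathbb H(\mathbb R^N): u=0 \text{ a.e. in } \mathbb R^N\setminus\Omega\}$. The bilinear form of the logarithmic Laplacian $L_\Delta$ (the operator with Fourier symbol $2\log|\xi|$) is $$\mathcal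 E_L(u,v)=\mathcal E(u,v)-\iint_{\mathbb R^N\times\mathbb R^N}u(x)v(y)\,j(x-y)\,dx\,dy+\rho_N\int_{\mathbb R^N}uv\,dx ,$$ which is well defined for $u\in\mathbb H(\mathbb R^N)$ and $v\in\mathbb H(\Omega)$ if $\Omega$ is bounded. For $u\in\mathbb H(\mathbb R^N)$ and $g\in L^2(\Omega)$, the inequality $L_\Delta u\ge g$ in $\Omega$ is meant in the weak sense: $\mathcal E_L(u,\phi)\ge\int_\Omega g\,\phi\,dx$ for every $\phi\in\mathbb H(\Omega)$ with $\phi\ge 0$ a.e. **Strong maximum principle.** Let $\Omega\subset\mathbb R^N$ be a bounded open set (not necessarily connected) with Lipschitz boundary, let $V\in L^\infty(\Omega)$, and let $u\in C(\mathbb R^N)\cap\mathbb H(\mathbb R^N)$ satisfy $$L_\Delta u\ge V(x)\,u\ \text{ in }\Omega,\qquad u\ge 0\ \text{ in }\mathbb R^N .$$ Then either $u>0$ in $\Omega$, or $u\equiv 0$ in $\mathbb R^N$. -/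

import Mathlib

noncomputable section

namespace LogLap

open MeasureTheory

/-- `ℝ^N` with its Euclidean norm. -/
abbrev E (N : ℕ) : Type := EuclideanSpace ℝ (Fin N)

/-- The constant `c_N = π^{-N/2} Γ(N/2)`. -/
def c (N : ℕ) : ℝ := Real.pi ^ (-((N : ℝ) / 2)) * Real.Gamma ((N : ℝ) / 2)

/-- The constant `ρ_N = 2 log 2 + ψ(N/2) - γ`, where `ψ = Γ'/Γ` is the digamma function and `γ` is the
Euler-Mascheroni constant. -/
def rho (N : ℕ) : ℝ :=
  2 * Real.log 2 + logDeriv Real.Gamma ((N : ℝ) / 2) - Real.eulerMascheroniConstant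

/-- The kernel `k(z) = c_N |z|^{-N} χ_{B_1}(z)`; its value at the origin is irrelevant. -/
def k {N : ℕ} (z : E N) : ℝ :=
  (Metric.ball (0 : E N) 1).indicator (fun w => c N / ‖w‖ ^ N) z

/-- The kernel `j(z) = c_N |z|^{-N} χ_{B_1^c}(z)`. -/
def j {N : ℕ} (z : E N) : ℝ :=
  (Metric.ball (0 : E N) 1)ᶜ.indicator (fun w => c N / ‖w‖ ^ N) z

/-- The bilinear form `𝓔(u,v) = ½ ∬ (u(x) - u(y)) (v(x) - v(y)) k(x - y) dx dy`. -/
def energy {N : ℕ} (u v : E N → ℝ) : ℝ :=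
  (1 / 2) * ∫ p : E N × E N, (u p.1 - u p.2) * (v p.1 - v p.2) * k (p.1 - p.2)

/-- `u ∈ ℍ(ℝ^N)`: `u` is (Lebesgue) measurable, `u ∈ L²(ℝ^N)` and `𝓔(u,u) < ∞`. -/
structure MemH {N : ℕ} (u : E N → ℝ) : Prop where
  memLp : MemLp u 2 volume
  energy_lt_top :
    ∫⁻ p : E N × E N, ENNReal.ofReal ((u p.1 - u p.2) ^ 2 * k (p.1 - p.2)) < ⊤

/-- `u ∈ ℍ(Ω)`: `u ∈ ℍ(ℝ^N)` and `u = 0` a.e. in the complement of `Ω`. -/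
structure MemHOn {N : ℕ} (Ω : Set (E N)) (u : E N → ℝ) : Prop where
  memH : MemH u
  ae_eq_zero : ∀ᵐ x : E N, x ∉ Ω → u x = 0

/-- The bilinear form of the logarithmic Laplacian,
`𝓔_L(u,v) = 𝓔(u,v) - ∬ u(x) v(y) j(x - y) dx dy + ρ_N ∫ u v dx`. -/
def energyL {N : ℕ} (u v : E N → ℝ) : ℝ :=
  energy u v - (∫ p : E N × E N, u p.1 * v p.2 * j (p.1 - p.2)) + rho N * ∫ x : E N, u x * v x

/-- For `u ∈ ℍ(ℝ^N)` and `g ∈ L²(Ω)`: `u` is a weak supersolution of `L_Δ φ = g` in `Ω`, that is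
`L_Δ u ≥ g` in `Ω` in the weak sense. -/
def IsWeakSupersolution {N : ℕ} (Ω : Set (E N)) (g u : E N → ℝ) : Prop :=
  ∀ φ : E N → ℝ, MemHOn Ω φ → (∀ᵐ x : E N, 0 ≤ φ x) → ∫ x in Ω, g x * φ x ≤ energyL u φ

/-- `Ω` has Lipschitz boundary: near each boundary point `Ω` is, in suitable orthonormal coordinates, the
set of points strictly above the graph of a Lipschitz function. Here `e` is the unit vector of the vertical
axis, `inner ℝ e y` is the vertical coordinate of `y`, and `y - inner ℝ e y • e` is its orthogonal projection
onto the hyperplane orthogonal to `e`; a Lipschitz function on this hyperplane is the same as the restriction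
of a Lipschitz function `γ` on the whole space. -/
def HasLipschitzBoundary {N : ℕ} (Ω : Set (E N)) : Prop :=
  ∀ x ∈ frontier Ω, ∃ (e : E N) (γ : E N → ℝ) (K : NNReal) (r : ℝ),
    ‖e‖ = 1 ∧ LipschitzWith K γ ∧ 0 < r ∧
      ∀ y ∈ Metric.ball x r, y ∈ Ω ↔ γ (y - inner ℝ e y • e) < inner ℝ e y

end LogLap

end

open MeasureTheory Set

namespace LogLap

variable {N : ℕ}

/-! The operator is nonlocal: `k + j` is positive at every distance, so positive mass of `u`
anywhere pushes `L_Δ u` down at a zero, and connectedness plays no role. Suppose `u x₀ = 0` with `x₀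
∈ Ω` and `u y₀ > 0`, where `y₀` may lie outside `Ω`. Let `η` be a Lipschitz tent at `x₀` and test
with `φ = (εη - u)⁺`. By `energyL_posPart_sub_le`, the mass of `u` near `y₀` contributes at most `-B
∫ φ` with `B > 0` independent of `ε`. All other terms, including the one with `V`, are at most `ε A
∫ φ`, because `0 ≤ u < ε` where `φ > 0` and `‖z‖ k(z)` is integrable. Since `∫ φ > 0`, a small `ε`
gives a contradiction. The pointwise core is `sub_mul_posPart_sub_le`. -/

/-! ### The kernels. -/

lemma c_pos (hN : 1 ≤ N) : 0 < c N := by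
  have h : (0 : ℝ) < (N : ℝ) / 2 := by
    have : (1 : ℝ) ≤ N := by exact_mod_cast hN
    linarith
  exact mul_pos (Real.rpow_pos_of_pos Real.pi_pos _) (Real.Gamma_pos_of_pos h)

lemma k_nonneg (hN : 1 ≤ N) (z : E N) : 0 ≤ k z :=
  indicator_nonneg (fun _ _ => div_nonneg (c_pos hN).le (by positivity)) z

lemma j_nonneg (hN : 1 ≤ N) (z : E N) : 0 ≤ j z :=
  indicator_nonneg (fun _ _ => div_nonneg (c_pos hN).le (by positivity)) z

lemma k_sub_comm (x y : E N) : k (x - y) = k (y - x) := by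
  simp only [k, indicator, Metric.mem_ball, dist_zero_right, norm_sub_rev x y]

lemma measurable_k : Measurable (k : E N → ℝ) :=
  (measurable_const.div (measurable_norm.pow_const N)).indicator measurableSet_ball

lemma measurable_j : Measurable (j : E N → ℝ) :=
  (measurable_const.div (measurable_norm.pow_const N)).indicator measurableSet_ball.compl

/-- In polar coordinates the integrand becomes the constant `c N` on `(0, 1)`: one factor `‖z‖`
removes the singularity. -/
lemma integrable_norm_mul_k (hN : 1 ≤ N) : Integrable (fun z : E N => ‖z‖ * k z) := by
  have : Nonempty (Fin N) := ⟨⟨0, hN⟩⟩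
  have h1 : (fun z : E N => ‖z‖ * k z) =
      (Metric.ball (0 : E N) 1).indicator (fun z => ‖z‖ * (c N / ‖z‖ ^ N)) := by
    ext z
    simp only [k, indicator]
    split_ifs <;> simp
  rw [h1, integrable_indicator_iff Metric.isOpen_ball.measurableSet,
    integrableOn_fun_norm_addHaar volume (f := fun t => t * (c N / t ^ N))]
  have h2 : IntegrableOn (fun _ : ℝ => c N) (Ioo 0 1) := by simp
  refine h2.congr_fun (fun t ht => ?_) measurableSet_Ioo
  have ht0 : t ≠ 0 := ht.1.ne'
  obtain ⟨n, rfl⟩ : ∃ n, N = n + 1 := ⟨N - 1, by omega⟩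
  simp only [finrank_euclideanSpace, Fintype.card_fin, Nat.add_sub_cancel, smul_eq_mul]
  field_simp
  ring

/-- `j` itself is not integrable (logarithmic divergence at infinity); its square is, since `1 + ‖z‖
≤ 2‖z‖` off the unit ball. -/
lemma integrable_j_sq (hN : 1 ≤ N) : Integrable (fun z : E N => j z ^ 2) := by
  have h := (integrable_one_add_norm (E := E N) (μ := volume) (r := ((2 * N : ℕ) : ℝ))
    (by rw [finrank_euclideanSpace, Fintype.card_fin]; exact_mod_cast (by omega : N < 2 * N))).const_mul ((c N * 2 ^ N) ^ 2)
  refine h.mono' (measurable_j.pow_const 2).aestronglyMeasurable (ae_of_all _ fun z => ?_)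
  rw [Real.norm_of_nonneg (sq_nonneg _), Real.rpow_neg (by positivity), Real.rpow_natCast,
    mul_comm 2 N, pow_mul, ← inv_pow, ← mul_pow]
  refine pow_le_pow_left₀ (j_nonneg hN z) ?_ 2
  have hc := (c_pos hN).le
  by_cases hz : z ∈ (Metric.ball (0 : E N) 1)ᶜ
  · have h1 : 1 ≤ ‖z‖ := by simpa using hz
    rw [j, indicator_of_mem hz, mul_assoc, ← div_eq_mul_inv, div_eq_mul_inv (c N)]
    refine mul_le_mul_of_nonneg_left ?_ hc
    rw [inv_eq_one_div, div_le_div_iff₀ (by positivity) (by positivity), one_mul, ← mul_pow]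
    exact pow_le_pow_left₀ (by positivity) (by linarith) N
  · rw [j, indicator_of_notMem hz]
    positivity

/-- The kernels `k` and `j` are bounded below by multiples of indicator functions on bounded sets. -/
lemma le_k {R : ℝ} (hN : 1 ≤ N) {z : E N} (hz : z ≠ 0) (hzR : ‖z‖ ≤ R) :
    (Metric.ball (0 : E N) 1).indicator (fun _ => c N / R ^ N) z ≤ k z := by
  refine indicator_le_indicator ?_
  have := norm_pos_iff.2 hz
  exact div_le_div_of_nonneg_left (c_pos hN).le (by positivity) (by gcongr)

lemma le_j {R : ℝ} (hN : 1 ≤ N) {z : E N} (hz : z ≠ 0) (hzR : ‖z‖ ≤ R) :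
    (Metric.ball (0 : E N) 1)ᶜ.indicator (fun _ => c N / R ^ N) z ≤ j z := by
  refine indicator_le_indicator ?_
  have := norm_pos_iff.2 hz
  exact div_le_div_of_nonneg_left (c_pos hN).le (by positivity) (by gcongr)

/-! ### Double integrals of convolution type. -/

lemma integrable_mul_comp_sub {f g : E N → ℝ} (hf : Integrable f) (hg : Integrable g) :
    Integrable (fun p : E N × E N => f p.2 * g (p.1 - p.2)) :=
  hf.convolution_integrand (ContinuousLinearMap.mul ℝ ℝ) hg

lemma integral_mul_comp_sub {f g : E N → ℝ} (hf : Integrable f) (hg : Integrable g) :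
    ∫ p : E N × E N, f p.2 * g (p.1 - p.2) = (∫ x, f x) * ∫ z, g z := by
  have h := integral_convolution (ContinuousLinearMap.mul ℝ ℝ) hf hg
  have h2 := integral_prod _ (integrable_mul_comp_sub hf hg)
  simp only [convolution, ContinuousLinearMap.mul_apply'] at h
  rw [← h]
  exact h2

lemma integrable_prod_swap {f : E N × E N → ℝ} (hf : Integrable f) :
    Integrable (fun p : E N × E N => f p.swap) :=
  Integrable.swap hf

lemma integral_comp_swap (f : E N × E N → ℝ) :
    ∫ p : E N × E N, f p.swap = ∫ p, f p :=
  integral_prod_swap f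

/-- `(x, y) ↦ (f x + f y) |x - y| k(x - y)` -/
lemma integrable_add_mul_norm_mul_k (hN : 1 ≤ N) {f : E N → ℝ} (hf : Integrable f) :
    Integrable (fun p : E N × E N => (f p.1 + f p.2) * (‖p.1 - p.2‖ * k (p.1 - p.2))) := by
  have h := integrable_mul_comp_sub hf (integrable_norm_mul_k hN)
  refine ((integrable_prod_swap h).add h).congr (ae_of_all _ fun p => ?_)
  simp only [Pi.add_apply, Prod.fst_swap, Prod.snd_swap]
  rw [norm_sub_rev p.2, k_sub_comm p.2]
  ring

lemma integral_add_mul_norm_mul_k (hN : 1 ≤ N) {f : E N → ℝ} (hf : Integrable f) :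
    ∫ p : E N × E N, (f p.1 + f p.2) * (‖p.1 - p.2‖ * k (p.1 - p.2)) =
      2 * ((∫ x, f x) * ∫ z : E N, ‖z‖ * k z) := by
  have h := integrable_mul_comp_sub hf (integrable_norm_mul_k hN)
  rw [← integral_mul_comp_sub hf (integrable_norm_mul_k hN), two_mul]
  conv_rhs => enter [1]; rw [← integral_comp_swap]
  rw [← integral_add (integrable_prod_swap h) h]
  refine integral_congr_ae (ae_of_all _ fun p => ?_)
  simp only [Prod.fst_swap, Prod.snd_swap]
  rw [norm_sub_rev p.2, k_sub_comm p.2]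
  ring

/-! ### The energy space and integrability of the forms. -/

lemma MemH.integrable_energy (hN : 1 ≤ N) {u : E N → ℝ} (hu : MemH u) (huc : Continuous u) :
    Integrable (fun p : E N × E N => (u p.1 - u p.2) ^ 2 * k (p.1 - p.2)) := by
  refine ⟨Measurable.aestronglyMeasurable ?_, ?_⟩
  · exact (((huc.comp continuous_fst).sub (huc.comp continuous_snd)).pow 2).measurable.mul
      (measurable_k.comp (measurable_fst.sub measurable_snd))
  · rw [hasFiniteIntegral_iff_ofReal
      (ae_of_all _ fun p => mul_nonneg (sq_nonneg _) (k_nonneg hN _))]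
    exact hu.energy_lt_top

lemma memH_of_integrable (hN : 1 ≤ N) {u : E N → ℝ} (hu : MemLp u 2 volume)
    (h : Integrable (fun p : E N × E N => (u p.1 - u p.2) ^ 2 * k (p.1 - p.2))) : MemH u := by
  refine ⟨hu, ?_⟩
  rw [← hasFiniteIntegral_iff_ofReal
    (ae_of_all _ fun p => mul_nonneg (sq_nonneg _) (k_nonneg hN _))]
  exact h.2

lemma memH_of_lipschitzWith (hN : 1 ≤ N) {η : E N → ℝ} {K : NNReal} (hη : LipschitzWith K η)
    (h0 : ∀ x, 0 ≤ η x) (hs : HasCompactSupport η) : MemH η := by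
  have hc := hη.continuous
  refine memH_of_integrable hN (hc.memLp_of_hasCompactSupport hs) ?_
  refine ((integrable_add_mul_norm_mul_k hN (hc.integrable_of_hasCompactSupport hs)).const_mul
    (K : ℝ)).mono' (Measurable.aestronglyMeasurable ?_) (ae_of_all _ fun p => ?_)
  · exact (((hc.comp continuous_fst).sub (hc.comp continuous_snd)).pow 2).measurable.mul
      (measurable_k.comp (measurable_fst.sub measurable_snd))
  · have hk := k_nonneg hN (p.1 - p.2)
    rw [Real.norm_of_nonneg (mul_nonneg (sq_nonneg _) hk)]
    -- One factor of the square uses the Lipschitz bound to tame `k`; the other uses `η ≥ 0` to keep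
    -- integrability at infinity.
    have h1 : |η p.1 - η p.2| ≤ K * ‖p.1 - p.2‖ := by
      simpa [Real.dist_eq, dist_eq_norm] using hη.dist_le_mul p.1 p.2
    have h2 : |η p.1 - η p.2| ≤ η p.1 + η p.2 :=
      abs_le.2 ⟨by linarith [h0 p.1, h0 p.2], by linarith [h0 p.1, h0 p.2]⟩
    calc (η p.1 - η p.2) ^ 2 * k (p.1 - p.2)
        = |η p.1 - η p.2| * |η p.1 - η p.2| * k (p.1 - p.2) := by rw [abs_mul_abs_self, sq]
      _ ≤ (η p.1 + η p.2) * (K * ‖p.1 - p.2‖) * k (p.1 - p.2) := by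
        gcongr
        exact add_nonneg (h0 _) (h0 _)
      _ = _ := by ring

/-- The positive part of `v - u` belongs to `ℍ(ℝ^N)` if `u` and `v` do, `u ≥ 0`. -/
lemma MemH.posPart_sub (hN : 1 ≤ N) {u v : E N → ℝ} (hu : MemH u) (huc : Continuous u)
    (hv : MemH v) (hvc : Continuous v) : MemH (fun x => max (v x - u x) 0) := by
  have hc : Continuous (fun x => max (v x - u x) 0) := (hvc.sub huc).max continuous_const
  refine memH_of_integrable hN ?_ ?_
  · refine (hv.memLp.sub hu.memLp).mono hc.aestronglyMeasurable (ae_of_all _ fun x => ?_)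
    simp only [Real.norm_eq_abs, Pi.sub_apply]
    rw [abs_of_nonneg (le_max_right _ _)]
    exact max_le (le_abs_self _) (abs_nonneg _)
  · refine (((hu.integrable_energy hN huc).add (hv.integrable_energy hN hvc)).const_mul 2).mono'
      (Measurable.aestronglyMeasurable ?_) (ae_of_all _ fun p => ?_)
    · exact (((hc.comp continuous_fst).sub (hc.comp continuous_snd)).pow 2).measurable.mul
        (measurable_k.comp (measurable_fst.sub measurable_snd))
    · have hk := k_nonneg hN (p.1 - p.2)
      rw [Real.norm_of_nonneg (mul_nonneg (sq_nonneg _) hk)]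
      simp only [Pi.add_apply]
      rw [← add_mul, ← mul_assoc]
      refine mul_le_mul_of_nonneg_right ?_ hk
      have h1 := abs_max_sub_max_le_abs (v p.1 - u p.1) (v p.2 - u p.2) 0
      have h2 := sq_le_sq.2 h1
      nlinarith [sq_nonneg ((v p.1 - v p.2) + (u p.1 - u p.2))]

lemma MemH.integrable_energy_mul (hN : 1 ≤ N) {u v : E N → ℝ} (hu : MemH u) (huc : Continuous u)
    (hv : MemH v) (hvc : Continuous v) :
    Integrable (fun p : E N × E N => (u p.1 - u p.2) * (v p.1 - v p.2) * k (p.1 - p.2)) := by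
  refine ((hu.integrable_energy hN huc).add (hv.integrable_energy hN hvc)).mono'
      (Measurable.aestronglyMeasurable ?_) (ae_of_all _ fun p => ?_)
  · exact (((huc.comp continuous_fst).sub (huc.comp continuous_snd)).mul
      ((hvc.comp continuous_fst).sub (hvc.comp continuous_snd))).measurable.mul
      (measurable_k.comp (measurable_fst.sub measurable_snd))
  · have hk := k_nonneg hN (p.1 - p.2)
    rw [Real.norm_eq_abs, abs_mul, abs_of_nonneg hk]
    simp only [Pi.add_apply]
    rw [← add_mul]
    refine mul_le_mul_of_nonneg_right ?_ hk
    rw [abs_le]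
    constructor <;> nlinarith [sq_nonneg ((u p.1 - u p.2) + (v p.1 - v p.2)),
      sq_nonneg ((u p.1 - u p.2) - (v p.1 - v p.2)), sq_nonneg (u p.1 - u p.2),
      sq_nonneg (v p.1 - v p.2)]

lemma integrable_mul_mul_j (hN : 1 ≤ N) {u v : E N → ℝ} (hu : MemLp u 2 volume)
    (hv : Integrable v) (hv0 : ∀ x, 0 ≤ v x) :
    Integrable (fun p : E N × E N => u p.1 * v p.2 * j (p.1 - p.2)) := by
  refine ((hu.integrable_sq.mul_prod hv).add (integrable_mul_comp_sub hv (integrable_j_sq hN))).mono'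
    (((hu.1.comp_fst).mul hv.1.comp_snd).mul
      (measurable_j.comp (measurable_fst.sub measurable_snd)).aestronglyMeasurable)
    (ae_of_all _ fun p => ?_)
  simp only [Pi.add_apply]
  -- Young's inequality separates `u²` from `j²`, both integrable.
  have : |u p.1 * j (p.1 - p.2)| ≤ u p.1 ^ 2 + j (p.1 - p.2) ^ 2 := by
    rw [abs_le]
    constructor <;> nlinarith [sq_nonneg (u p.1 + j (p.1 - p.2)),
      sq_nonneg (u p.1 - j (p.1 - p.2)), sq_nonneg (u p.1), sq_nonneg (j (p.1 - p.2))]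
  calc ‖u p.1 * v p.2 * j (p.1 - p.2)‖ = v p.2 * |u p.1 * j (p.1 - p.2)| := by
        rw [Real.norm_eq_abs, mul_right_comm, abs_mul, abs_of_nonneg (hv0 _), mul_comm]
    _ ≤ v p.2 * (u p.1 ^ 2 + j (p.1 - p.2) ^ 2) := mul_le_mul_of_nonneg_left this (hv0 _)
    _ = _ := by ring

/-! ### The estimate for the test function. -/

/-- Used with `a, b` values of `u` and `s, t` values of `εη` at two points. If both positive parts
`p, q` are positive, then `g = h = 0` and `a - b = (s - t) - (p - q)`, so only `-(p - q)²` is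
discarded. If just one is positive, the gap at the other point absorbs `g` or `h`. -/
lemma sub_mul_posPart_sub_le {a b s t g h : ℝ} (hga : g ≤ a) (hhb : h ≤ b) (hg0 : 0 ≤ g)
    (hh0 : 0 ≤ h) (hgs : g ≠ 0 → s = 0) (hht : h ≠ 0 → t = 0) :
    (a - b) * (max (s - a) 0 - max (t - b) 0) ≤
      |s - t| * (max (s - a) 0 + max (t - b) 0) - g * max (t - b) 0 - h * max (s - a) 0 := by
  have h1 := le_abs_self (s - t)
  have h2 := neg_abs_le (s - t)
  have key : ∀ {a s g : ℝ}, g ≤ a → 0 ≤ g → (g ≠ 0 → s = 0) →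
      (0 < s - a → g = 0) ∧ (s - a ≤ 0 → g ≤ a - s) := by
    intro a s g h1 h2 h3
    by_cases hg : g = 0
    · exact ⟨fun _ => hg, fun h => by linarith⟩
    · have := h3 hg
      exact ⟨fun h => by linarith, fun h => by linarith⟩
  obtain ⟨hx1, hx2⟩ := key hga hg0 hgs
  obtain ⟨hy1, hy2⟩ := key hhb hh0 hht
  rcases lt_or_ge 0 (s - a) with hx | hx <;> rcases lt_or_ge 0 (t - b) with hy | hy
  · rw [max_eq_left hx.le, max_eq_left hy.le, hx1 hx, hy1 hy]
    nlinarith [sq_nonneg ((s - a) - (t - b)), mul_nonneg hx.le (sub_nonneg.2 h1),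
      mul_nonneg hy.le (sub_nonneg.2 h2)]
  · rw [max_eq_left hx.le, max_eq_right hy]
    nlinarith [mul_nonneg hx.le (by linarith [hy2 hy] : 0 ≤ |s - t| - h - (a - b))]
  · rw [max_eq_right hx, max_eq_left hy.le]
    nlinarith [mul_nonneg hy.le (by linarith [hx2 hx] : 0 ≤ |s - t| - g - (b - a))]
  · rw [max_eq_right hx, max_eq_right hy]
    simp

/-- The form `𝓔_L(u, φ)` for the test function `φ = (ε η - u)⁺`, where `η` is a Lipschitz cut-off
function and `g ≤ u` is supported where `η` vanishes, at distance at most `R` from its support. -/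
lemma energyL_posPart_sub_le (hN : 1 ≤ N) {u η g : E N → ℝ} {K : NNReal} {ε R : ℝ}
    (huc : Continuous u) (hu : MemH u) (hu0 : ∀ x, 0 ≤ u x)
    (hη : LipschitzWith K η) (hη1 : ∀ x, η x ≤ 1)
    (hg : Integrable g) (hg0 : ∀ x, 0 ≤ g x) (hgu : ∀ x, g x ≤ u x)
    (hgη : ∀ x, g x ≠ 0 → η x = 0)
    (hR : ∀ x y, g x ≠ 0 → η y ≠ 0 → ‖x - y‖ ≤ R) (hε : 0 < ε)
    (hφi : Integrable (fun x => max (ε * η x - u x) 0))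
    (hφm : MemH (fun x => max (ε * η x - u x) 0)) :
    energyL u (fun x => max (ε * η x - u x) 0) ≤
      (ε * (K * (∫ z : E N, ‖z‖ * k z) + |rho N|) - c N / R ^ N * ∫ x, g x) *
        ∫ x, max (ε * η x - u x) 0 := by
  set φ : E N → ℝ := fun x => max (ε * η x - u x) 0 with hφ
  have hφ0 : ∀ x, 0 ≤ φ x := fun x => le_max_right _ _
  have hφη : ∀ x, φ x ≠ 0 → 0 < η x ∧ u x < ε * η x := by
    intro x hx
    have h1 : 0 < ε * η x - u x := by
      by_contra! h
      exact hx (max_eq_right h)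
    have h2 : 0 < ε * η x := by linarith [hu0 x]
    exact ⟨(mul_pos_iff_of_pos_left hε).1 h2, by linarith⟩
  have hφc : Continuous φ := ((hη.continuous.const_mul ε).sub huc).max continuous_const
  set S : Set (E N × E N) := {p | p.1 - p.2 ∈ Metric.ball (0 : E N) 1} with hS
  have hSm : MeasurableSet S :=
    (measurable_fst.sub measurable_snd) measurableSet_ball
  -- Pairs in `S` are paid for by `k`, the rest by `j`; together they give the full product integral
  -- of `f`.
  set f : E N × E N → ℝ := fun p => c N / R ^ N * (g p.1 * φ p.2) with hf
  have hfi : Integrable f := (hg.mul_prod hφi).const_mul _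
  have hfint : ∫ p, f p = c N / R ^ N * ((∫ x, g x) * ∫ x, φ x) := by
    rw [hf, integral_const_mul]
    congr 1
    exact integral_prod_mul g φ
  have hsplit : (∫ p in S, f p) + ∫ p in Sᶜ, f p = ∫ p, f p := integral_add_compl hSm hfi
  have hne : ∀ x y, g x ≠ 0 → φ y ≠ 0 → x - y ≠ 0 ∧ ‖x - y‖ ≤ R := by
    intro x y hx hy
    refine ⟨fun h => ?_, hR x y hx (hφη y hy).1.ne'⟩
    rw [sub_eq_zero] at h
    exact (hφη y hy).1.ne' (h ▸ hgη x hx)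
  have hker : ∀ (B : Set (E N)) (q : E N → ℝ),
      (∀ z, z ≠ 0 → ‖z‖ ≤ R → B.indicator (fun _ => c N / R ^ N) z ≤ q z) →
      ∀ p, {p : E N × E N | p.1 - p.2 ∈ B}.indicator f p ≤ g p.1 * φ p.2 * q (p.1 - p.2) := by
    intro B q hq p
    by_cases hp : g p.1 * φ p.2 = 0
    · by_cases hpB : p.1 - p.2 ∈ B <;> simp [indicator, hf, hp, hpB]
    · obtain ⟨h1, h2⟩ := mul_ne_zero_iff.1 hp
      obtain ⟨h3, h4⟩ := hne _ _ h1 h2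
      refine le_trans (le_of_eq ?_)
        (mul_le_mul_of_nonneg_left (hq _ h3 h4) (mul_nonneg (hg0 p.1) (hφ0 p.2)))
      by_cases hpB : p.1 - p.2 ∈ B <;> simp [indicator, hf, hpB, mul_comm]
  have hfk : ∀ p, S.indicator f p ≤ g p.1 * φ p.2 * k (p.1 - p.2) :=
    hker _ k fun z hz hzR => le_k hN hz hzR
  have hfj : ∀ p, Sᶜ.indicator f p ≤ u p.1 * φ p.2 * j (p.1 - p.2) := fun p =>
    (hker _ j (fun z hz hzR => le_j hN hz hzR) p).trans (mul_le_mul_of_nonneg_right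
      (mul_le_mul_of_nonneg_right (hgu p.1) (hφ0 p.2)) (j_nonneg hN _))
  have hE : energy u φ ≤ ε * K * ((∫ x, φ x) * ∫ z : E N, ‖z‖ * k z) - ∫ p in S, f p := by
    have hI := integrable_add_mul_norm_mul_k hN hφi
    have hTi : Integrable (S.indicator f) := hfi.indicator hSm
    have hTT : Integrable (fun p => S.indicator f p + S.indicator f p.swap) :=
      hTi.add (integrable_prod_swap hTi)
    have hle : ∫ p : E N × E N, (u p.1 - u p.2) * (φ p.1 - φ p.2) * k (p.1 - p.2) ≤
        ∫ p : E N × E N, (ε * K * ((φ p.1 + φ p.2) * (‖p.1 - p.2‖ * k (p.1 - p.2))) -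
          (S.indicator f p + S.indicator f p.swap)) := by
      refine integral_mono (hu.integrable_energy_mul hN huc hφm hφc)
        ((hI.const_mul _).sub hTT) fun p => ?_
      have hk := k_nonneg hN (p.1 - p.2)
      have h1 := hfk p
      have h2 := hfk p.swap
      rw [Prod.fst_swap, Prod.snd_swap, k_sub_comm] at h2
      have h3 := sub_mul_posPart_sub_le (hgu p.1) (hgu p.2) (hg0 p.1) (hg0 p.2)
        (s := ε * η p.1) (t := ε * η p.2) (fun h => by rw [hgη _ h, mul_zero])
        (fun h => by rw [hgη _ h, mul_zero])
      have h4 : |ε * η p.1 - ε * η p.2| ≤ ε * K * ‖p.1 - p.2‖ := by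
        rw [← mul_sub, abs_mul, abs_of_pos hε, mul_assoc]
        have := hη.dist_le_mul p.1 p.2
        rw [Real.dist_eq, dist_eq_norm] at this
        exact mul_le_mul_of_nonneg_left this hε.le
      have h5 := mul_le_mul_of_nonneg_right h4 (add_nonneg (hφ0 p.1) (hφ0 p.2))
      have h6 := mul_le_mul_of_nonneg_right (h3.trans
        (sub_le_sub_right (sub_le_sub_right h5 _) _)) hk
      dsimp only
      refine h6.trans ?_
      simp only [hφ] at h1 h2 ⊢
      linarith
    -- The swapped copy has the same integral, so the factor `1/2` in the energy leaves exactly one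
    -- `∫ p in S, f p`.
    rw [integral_sub (hI.const_mul _) hTT,
      integral_add hTi (integrable_prod_swap hTi), integral_comp_swap, integral_const_mul,
      integral_add_mul_norm_mul_k hN hφi, integral_indicator hSm] at hle
    rw [energy]
    linarith
  have hJ : ∫ p in Sᶜ, f p ≤ ∫ p : E N × E N, u p.1 * φ p.2 * j (p.1 - p.2) := by
    rw [← integral_indicator hSm.compl]
    exact integral_mono (hfi.indicator hSm.compl) (integrable_mul_mul_j hN hu.memLp hφi hφ0) hfj
  have hρ : rho N * ∫ x, u x * φ x ≤ |rho N| * (ε * ∫ x, φ x) := by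
    have h1 : ∫ x, u x * φ x ≤ ε * ∫ x, φ x := by
      rw [← integral_const_mul]
      refine integral_mono_of_nonneg (ae_of_all _ fun x => mul_nonneg (hu0 x) (hφ0 x))
        (hφi.const_mul _) (ae_of_all _ fun x => ?_)
      by_cases hx : φ x = 0
      · simp [hx]
      · refine mul_le_mul_of_nonneg_right ?_ (hφ0 x)
        nlinarith [(hφη x hx).2, hη1 x]
    have h0 : 0 ≤ ∫ x, u x * φ x := integral_nonneg fun x => mul_nonneg (hu0 x) (hφ0 x)
    exact (mul_le_mul_of_nonneg_right (le_abs_self _) h0).trans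
      (mul_le_mul_of_nonneg_left h1 (abs_nonneg _))
  rw [energyL]
  rw [hfint] at hsplit
  linarith

end LogLap

/-! ### The strong maximum principle. -/

open LogLap in
theorem mainTheorem12 (N : ℕ) (hN : 1 ≤ N)
    (Ω : Set (LogLap.E N)) (hΩ_open : IsOpen Ω) (hΩ_bdd : Bornology.IsBounded Ω)
    (hΩ_lip : LogLap.HasLipschitzBoundary Ω)
    (V : LogLap.E N → ℝ)
    (hV : MeasureTheory.MemLp V ⊤ (MeasureTheory.volume.restrict Ω))
    (u : LogLap.E N → ℝ) (hu_cont : Continuous u) (hu_mem : LogLap.MemH u)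
    (hu_super : LogLap.IsWeakSupersolution Ω (fun x => V x * u x) u)
    (hu_nonneg : ∀ x, 0 ≤ u x) :
    (∀ x ∈ Ω, 0 < u x) ∨ (∀ x, u x = 0) := by
  by_contra! ⟨⟨x₀, hx₀Ω, hx₀⟩, ⟨y₀, hy₀⟩⟩
  replace hx₀ : u x₀ = 0 := le_antisymm hx₀ (hu_nonneg x₀)
  have hd : 0 < dist x₀ y₀ := dist_pos.2 fun h => hy₀ (h ▸ hx₀)
  obtain ⟨s, hs, hsΩ⟩ := Metric.isOpen_iff.1 hΩ_open x₀ hx₀Ω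
  -- `r ≤ s` keeps the support of `φ` in `Ω`; `2 * r ≤ dist x₀ y₀` makes the balls around `x₀` and
  -- `y₀` disjoint.
  obtain ⟨r, hr, hrs, hrd⟩ : ∃ r, 0 < r ∧ r ≤ s ∧ 2 * r ≤ dist x₀ y₀ :=
    ⟨min s (dist x₀ y₀ / 2), by positivity, min_le_left _ _,
      by linarith [min_le_right s (dist x₀ y₀ / 2)]⟩
  set η : E N → ℝ := fun x => max (1 - r⁻¹ * dist x x₀) 0 with hηdef
  have hη : LipschitzWith (r⁻¹).toNNReal η := by
    refine LipschitzWith.max_const (LipschitzWith.of_dist_le_mul fun x y => ?_) 0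
    rw [Real.coe_toNNReal _ (inv_nonneg.2 hr.le), Real.dist_eq, sub_sub_sub_cancel_left,
      ← mul_sub, abs_mul, abs_of_pos (inv_pos.2 hr), abs_sub_comm]
    exact mul_le_mul_of_nonneg_left (abs_dist_sub_le x y x₀) (inv_nonneg.2 hr.le)
  have hη0 : ∀ x, 0 ≤ η x := fun x => le_max_right _ _
  have hη1 : ∀ x, η x ≤ 1 := fun x => max_le
    (sub_le_self _ (mul_nonneg (inv_nonneg.2 hr.le) dist_nonneg)) zero_le_one
  have hηz : ∀ x, r ≤ dist x x₀ → η x = 0 := by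
    intro x hx
    refine max_eq_right (sub_nonpos.2 ?_)
    rwa [inv_mul_eq_div, one_le_div hr]
  have hηsupp : ∀ x, η x ≠ 0 → dist x x₀ < r := fun x hx => by
    by_contra! h
    exact hx (hηz x h)
  have hηs : HasCompactSupport η :=
    HasCompactSupport.intro (isCompact_closedBall x₀ r) fun x hx => hηz x (by
      rw [Metric.mem_closedBall, not_le] at hx
      exact hx.le)
  set g : E N → ℝ := (Metric.ball y₀ r).indicator u with hgdef
  have hg : Integrable g :=
    ((hu_cont.continuousOn.integrableOn_compact (isCompact_closedBall y₀ r)).mono_set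
      Metric.ball_subset_closedBall).integrable_indicator measurableSet_ball
  have hg0 : ∀ x, 0 ≤ g x := indicator_nonneg fun x _ => hu_nonneg x
  have hgu : ∀ x, g x ≤ u x := indicator_le_self' fun x _ => hu_nonneg x
  have hgsupp : ∀ x, g x ≠ 0 → dist x y₀ < r := fun x hx =>
    mem_of_indicator_ne_zero (s := Metric.ball y₀ r) hx
  have hgη : ∀ x, g x ≠ 0 → η x = 0 := by
    intro x hx
    refine hηz x ?_
    linarith [hgsupp x hx, dist_triangle_left x₀ y₀ x]
  set R : ℝ := dist x₀ y₀ + 2 * r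
  have hRpos : 0 < R := by positivity
  have hR : ∀ x y, g x ≠ 0 → η y ≠ 0 → ‖x - y‖ ≤ R := by
    intro x y hx hy
    rw [← dist_eq_norm]
    linarith [hgsupp x hx, hηsupp y hy, dist_triangle4_right x y y₀ x₀, dist_comm x₀ y₀]
  have hG : 0 < ∫ x, g x := by
    refine (integral_pos_iff_support_of_nonneg hg0 hg).2 ?_
    rw [hgdef, support_indicator]
    exact (Metric.isOpen_ball.inter hu_cont.isOpen_support).measure_pos volume
      ⟨y₀, Metric.mem_ball_self hr, hy₀⟩
  obtain ⟨C, hC0, hC⟩ : ∃ C : ℝ, 0 ≤ C ∧ ∀ᵐ x, x ∈ Ω → |V x| ≤ C := by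
    refine ⟨(eLpNormEssSup V (volume.restrict Ω)).toReal, ENNReal.toReal_nonneg, ?_⟩
    rw [← ae_restrict_iff' hΩ_open.measurableSet]
    filter_upwards [ae_le_eLpNormEssSup (f := V) (μ := volume.restrict Ω)] with x hx
    have h := ENNReal.toReal_mono (by simpa using hV.eLpNorm_ne_top) hx
    simpa using h
  set M := ∫ z : E N, ‖z‖ * k z
  have hM0 : 0 ≤ M := integral_nonneg fun z => mul_nonneg (norm_nonneg _) (k_nonneg hN z)
  set A : ℝ := (r⁻¹).toNNReal * M + |rho N| + C with hA
  have hA0 : 0 ≤ A :=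
    add_nonneg (add_nonneg (mul_nonneg NNReal.zero_le_coe hM0) (abs_nonneg _)) hC0
  set B : ℝ := c N / R ^ N * ∫ x, g x
  have hB0 : 0 < B := mul_pos (div_pos (c_pos hN) (pow_pos hRpos N)) hG
  -- Neither `A` nor `B` depends on `ε`.
  obtain ⟨ε, hε, hεA⟩ : ∃ ε : ℝ, 0 < ε ∧ ε * A < B := by
    refine ⟨B / (A + 1), div_pos hB0 (by linarith), ?_⟩
    rw [div_mul_eq_mul_div, div_lt_iff₀ (by linarith)]
    exact mul_lt_mul_of_pos_left (lt_add_one A) hB0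
  set φ : E N → ℝ := fun x => max (ε * η x - u x) 0 with hφ
  have hφ0 : ∀ x, 0 ≤ φ x := fun x => le_max_right _ _
  have hφc : Continuous φ := ((hη.continuous.const_mul ε).sub hu_cont).max continuous_const
  have hφη : ∀ x, η x = 0 → φ x = 0 := fun x hx =>
    max_eq_right (by rw [hx, mul_zero]; linarith [hu_nonneg x])
  have hφs : HasCompactSupport φ := hηs.mono fun x hx h => hx (hφη x h)
  have hφi : Integrable φ := hφc.integrable_of_hasCompactSupport hφs
  have hεη : LipschitzWith (ε.toNNReal * (r⁻¹).toNNReal) (fun x => ε * η x) := by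
    refine LipschitzWith.of_dist_le_mul fun x y => ?_
    rw [Real.dist_eq, ← mul_sub, abs_mul, abs_of_pos hε, NNReal.coe_mul,
      Real.coe_toNNReal _ hε.le, mul_assoc]
    exact mul_le_mul_of_nonneg_left (hη.dist_le_mul x y) hε.le
  have hφm : MemH φ := hu_mem.posPart_sub hN hu_cont
    (memH_of_lipschitzWith hN hεη (fun x => mul_nonneg hε.le (hη0 x)) hηs.mul_left) hεη.continuous
  have hφΩ : MemHOn Ω φ := ⟨hφm, ae_of_all _ fun x hx => hφη x (by
    by_contra h
    exact hx (hsΩ ((hηsupp x h).trans_le hrs)))⟩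
  have hI : 0 < ∫ x, φ x := by
    refine (integral_pos_iff_support_of_nonneg hφ0 hφi).2 ?_
    -- `φ x₀ = ε`, because `η x₀ = 1` and `u x₀ = 0`.
    refine hφc.isOpen_support.measure_pos volume ⟨x₀, ?_⟩
    simp [hφ, hηdef, hx₀, hε]
  have h1 := hu_super φ hφΩ (ae_of_all _ hφ0)
  have h2 := energyL_posPart_sub_le hN hu_cont hu_mem hu_nonneg hη hη1 hg hg0 hgu hgη hR hε
    hφi hφm
  have h3 : -(C * ε * ∫ x, φ x) ≤ ∫ x in Ω, V x * u x * φ x := by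
    refine neg_le_of_abs_le ?_
    rw [← Real.norm_eq_abs, ← integral_const_mul]
    refine (norm_integral_le_of_norm_le ((hφi.const_mul (C * ε)).integrableOn) ?_).trans
      (setIntegral_le_integral (hφi.const_mul _) (ae_of_all _ fun x =>
        mul_nonneg (mul_nonneg hC0 hε.le) (hφ0 x)))
    rw [ae_restrict_iff' hΩ_open.measurableSet]
    filter_upwards [hC] with x hx hxΩ
    have hux : u x * φ x ≤ ε * φ x := by
      rcases le_total (ε * η x - u x) 0 with h | h
      · simp [hφ, max_eq_right h]
      · refine mul_le_mul_of_nonneg_right ?_ (hφ0 x)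
        nlinarith [hη1 x]
    rw [mul_assoc, Real.norm_eq_abs, abs_mul, abs_of_nonneg (mul_nonneg (hu_nonneg x) (hφ0 x)),
      mul_assoc]
    exact mul_le_mul (hx hxΩ) hux (mul_nonneg (hu_nonneg x) (hφ0 x)) hC0
  have h4 : 0 ≤ (ε * A - B) * ∫ x, φ x := by
    have := h3.trans (h1.trans h2)
    rw [hA]
    linarith
  exact absurd h4 (not_le.2 (mul_neg_of_neg_of_pos (by linarith) hI))
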